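/- Let $d\ge 1$ be an integer and let $S\subseteq\mathbb R^d$. A set $L\subseteq\mathbb R^d$ is called $S$-free if it is closed and convex and its interior is disjoint from $S$; it is maximal $S$-free if moreover no $S$-free set properly contains it. Let $f(S)$ be the least $k\in\{0,1,2,\dots\}$ such that every $d$-dimensional maximal $S$-free set is a polyhedron with at most $k$ facets, with $f(S)=+\infty$ if no such $k$ exists, and $f(S)=-\infty$ if there are no $d$-dimensional maximal $S$-free sets. A set is called $S$-convex if it has the form $S\cap C$ with $C\subseteq\mathbb R^d$ convex. Let $h(S)$ be the Helly number of the family of all $S$-convex sets, that is, the least $k\in\{1,2,\dots\}$ such that for all $m\ge 1$ and all $S$-convex sets $F_1,\dots,F_m$ with $F_1\cap\dots\cap F_m=\emptyset$ there are $i_1,\dots,i_k\in\{1,\dots,m\}$ with $F_{i_1}\cap\dots\cap F_{i_k}=\emptyset$, and $h(S)=+\infty$ if no such $k$ exists; for $S=\emptyset$ one puts $h(S)=0$. Then $$h(\mathbb Z^d)=f(\mathbb Z^d)=2^d .$$ Moreover: (a) The sets $\{0,1\}^d\setminus\{z\}$ with $z\in\{0,1\}^d$ form a family of exactly $2^d$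 $\mathbb Z^d$-convex sets whose intersection is empty, while every proper subfamily of it has nonempty intersection. (b) For $S_t:=\mathbb Z^d\cap[-t,t]^d$, $t=1,2,\dots$, one has $f(\mathbb Z^d)\le\liminf_{t\to\infty}f(S_t)$, and $f(S_t)\le 2^d$ for every $t\ge 1$. -/

import Mathlib

open Set Filter

noncomputable section

/-- `L` is `S`-free: closed, convex, and its interior is disjoint from `S`. -/
def IsSFree {d : ℕ} (S L : Set (EuclideanSpace ℝ (Fin d))) : Prop :=
  IsClosed L ∧ Convex ℝ L ∧ Disjoint (interior L) S

/-- `L` is maximal `S`-free: it is `S`-free and no `S`-free set properly contains it. -/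
def IsMaximalSFree {d : ℕ} (S L : Set (EuclideanSpace ℝ (Fin d))) : Prop :=
  IsSFree S L ∧ ∀ K : Set (EuclideanSpace ℝ (Fin d)), IsSFree S K → ¬ L ⊂ K

/-- `L ⊆ ℝ^d` is `d`-dimensional: its affine hull is the whole space. -/
def IsFullDimensional {d : ℕ} (L : Set (EuclideanSpace ℝ (Fin d))) : Prop :=
  affineSpan ℝ L = ⊤

/-- A polyhedron: the solution set of a finite (possibly empty) system of linear inequalities
`⟨u i, x⟩ ≤ β i`. -/
def IsPolyhedron {d : ℕ} (P : Set (EuclideanSpace ℝ (Fin d))) : Prop :=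
  ∃ (m : ℕ) (u : Fin m → EuclideanSpace ℝ (Fin d)) (β : Fin m → ℝ),
    P = {x | ∀ i, inner ℝ (u i) x ≤ β i}

/-- `F` is a facet of `P`: a nonempty (exposed) face of `P` whose dimension is `dim P - 1`. -/
def IsFacet {d : ℕ} (P F : Set (EuclideanSpace ℝ (Fin d))) : Prop :=
  IsExposed ℝ P F ∧ F.Nonempty ∧
    Module.finrank ℝ (vectorSpan ℝ F) + 1 = Module.finrank ℝ (vectorSpan ℝ P)

/-- Every `d`-dimensional maximal `S`-free set is a polyhedron with at most `k` facets. -/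
def FacetBound {d : ℕ} (S : Set (EuclideanSpace ℝ (Fin d))) (k : ℕ) : Prop :=
  ∀ L : Set (EuclideanSpace ℝ (Fin d)), IsMaximalSFree S L → IsFullDimensional L →
    IsPolyhedron L ∧ {F | IsFacet L F}.encard ≤ (k : ℕ∞)

open Classical in
/-- The functional `f(S)`, with values in `{-∞} ∪ {0, 1, 2, …} ∪ {+∞}`: it is `-∞` if there is no
`d`-dimensional maximal `S`-free set; otherwise it is the least `k` such that every
`d`-dimensional maximal `S`-free set is a polyhedron with at most `k` facets, and `+∞` if there is
no such `k` (the infimum of the empty family in `ℕ∞` is `⊤`). -/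
def facetComplexity {d : ℕ} (S : Set (EuclideanSpace ℝ (Fin d))) : WithBot ℕ∞ :=
  if ∃ L : Set (EuclideanSpace ℝ (Fin d)), IsMaximalSFree S L ∧ IsFullDimensional L then
    ((⨅ (k : ℕ) (_ : FacetBound S k), (k : ℕ∞) : ℕ∞) : WithBot ℕ∞)
  else ⊥

/-- `A` is `S`-convex: the intersection of `S` with a convex set. -/
def IsSConvex {d : ℕ} (S A : Set (EuclideanSpace ℝ (Fin d))) : Prop :=
  ∃ C : Set (EuclideanSpace ℝ (Fin d)), Convex ℝ C ∧ A = S ∩ C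

/-- Whenever finitely many (at least one) members of `𝓕` have empty intersection, some `k` of
them, chosen with repetitions allowed, have empty intersection. -/
def HellyCondition {α : Type*} (𝓕 : Set (Set α)) (k : ℕ) : Prop :=
  ∀ m : ℕ, 1 ≤ m → ∀ F : Fin m → Set α, (∀ i, F i ∈ 𝓕) → ⋂ i, F i = ∅ →
    ∃ ι : Fin k → Fin m, ⋂ j, F (ι j) = ∅

open Classical in
/-- The Helly number of a family of sets: `0` for the family `{∅}`, otherwise the least `k ≥ 1`
satisfying the Helly condition, and `+∞` if there is none. -/
def hellyNumber {α : Type*} (𝓕 : Set (Set α)) : ℕ∞ :=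
  if 𝓕 = {∅} then 0 else ⨅ (k : ℕ) (_ : 1 ≤ k ∧ HellyCondition 𝓕 k), (k : ℕ∞)

/-- The functional `h(S)`: the Helly number of the family of all `S`-convex sets. -/
def sHellyNumber {d : ℕ} (S : Set (EuclideanSpace ℝ (Fin d))) : ℕ∞ :=
  hellyNumber {A | IsSConvex S A}

/-- The set `ℤ^d` of integer points of `ℝ^d`. -/
def integerPoints (d : ℕ) : Set (EuclideanSpace ℝ (Fin d)) :=
  {x | ∀ i, ∃ n : ℤ, x i = (n : ℝ)}

/-- The set `ℤ^d ∩ [-t, t]^d`. -/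
def integerBox (d t : ℕ) : Set (EuclideanSpace ℝ (Fin d)) :=
  integerPoints d ∩ {x | ∀ i, x i ∈ Icc (-(t : ℝ)) (t : ℝ)}

/-- The vertex set `{0, 1}^d` of the unit cube. -/
def cubeVertices (d : ℕ) : Set (EuclideanSpace ℝ (Fin d)) :=
  {x | ∀ i, x i = 0 ∨ x i = 1}

/-- The family of all sets `{0, 1}^d \ {z}` with `z ∈ {0, 1}^d`. -/
def puncturedCubes (d : ℕ) : Set (Set (EuclideanSpace ℝ (Fin d))) :=
  (fun z => cubeVertices d \ {z}) '' cubeVertices d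

end

/-! The upper bounds rest on Bell's parity argument. In a minimal infeasible system of strict linear
inequalities on the integer points of a box, the right-hand sides can be raised until each
inequality has a point attaining equality in it and satisfying all the others
(`exists_tight_relaxation`). If there were more than 2^d inequalities, two of these points would
agree mod 2, and their midpoint would be an integer point of the box satisfying the whole system.
Separating each point of the box from some set of the family turns the Helly property into such a
system (`hellyCondition_of_finite`). Doignon's theorem for ℤ^d follows because finitely many
witnesses fit into one box.

For facets, fix c in the interior of a maximal free set L. Helly's property, applied to half-spaces,
selects 2^d vectors of the polar of L at c that keep all points of a given box out of the interior;
compactness of the polar yields one tuple that serves all boxes. The polyhedron it defines is free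
and contains L, hence equals L (`facetBound_of_exhaustion`).

Both lower bounds come from the unit cube: the punctured cubes for h, and for f the ℓ¹-ball
circumscribed about the cube, which has a facet through each vertex. The latter needs only {0,1}^d ⊆
S ⊆ ℤ^d, so f(S_t) = 2^d for every t ≥ 1 and the liminf inequality is an equality. -/

/-- A finite set of at most `k` elements is covered by a `k`-tuple. -/
theorem exists_fin_tuple_range_superset {α : Type*} [Nonempty α] (s : Finset α) {k : ℕ}
    (h : s.card ≤ k) : ∃ f : Fin k → α, (s : Set α) ⊆ range f := by
  classical
  refine ⟨fun j => if hj : (j : ℕ) < s.card then (s.equivFin.symm ⟨j, hj⟩ : α)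
    else Classical.arbitrary α, fun x hx => ?_⟩
  refine ⟨⟨s.equivFin ⟨x, hx⟩, (s.equivFin ⟨x, hx⟩).2.trans_le h⟩, ?_⟩
  simp

/-! ### Bell's parity argument for systems of strict inequalities -/

section Helly

variable {E ι κ : Type*} [AddCommGroup E] [Module ℝ E] {X : Set E}

/-- The right-hand sides of a minimal infeasible system of strict inequalities on a finite set can
be relaxed until each inequality is violated with equality by some point satisfying all others. -/
theorem exists_tight_relaxation (hX : X.Finite) (M : Finset ι) (a : ι → E →ₗ[ℝ] ℝ) (b : ι → ℝ)
    (hempty : ∀ x ∈ X, ∃ i ∈ M, b i ≤ a i x)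
    (hmin : ∀ i ∈ M, ∃ x ∈ X, ∀ j ∈ M, j ≠ i → a j x < b j) (J : Finset ι) (hJ : J ⊆ M) :
    ∃ b' : ι → ℝ, (∀ x ∈ X, ∃ i ∈ M, b' i ≤ a i x) ∧
      (∀ i ∈ M, ∃ x ∈ X, ∀ j ∈ M, j ≠ i → a j x < b' j) ∧
      ∀ i ∈ J, ∃ x ∈ X, a i x = b' i ∧ ∀ j ∈ M, j ≠ i → a j x < b' j := by
  classical
  induction J using Finset.induction_on with
  | empty => exact ⟨b, hempty, hmin, by simp⟩
  | insert i J hi ih =>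
    obtain ⟨b', h1, h2, h3⟩ := ih ((Finset.subset_insert _ _).trans hJ)
    have hiM : i ∈ M := hJ (Finset.mem_insert_self _ _)
    -- The new bound for i is the least value of `a i` on the points satisfying the other
    -- inequalities. Minimality keeps the system infeasible; since bounds only increase, earlier
    -- tight points survive.
    obtain ⟨p, ⟨hpX, hp⟩, hpmin⟩ := Set.exists_min_image
      {x ∈ X | ∀ j ∈ M, j ≠ i → a j x < b' j} (a i) (hX.subset (sep_subset _ _)) (h2 i hiM)
    have hb : b' i ≤ a i p := by
      obtain ⟨j, hjM, hj⟩ := h1 p hpX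
      by_cases hji : j = i
      · exact hji ▸ hj
      · exact absurd (hp j hjM hji) (not_lt.2 hj)
    have hle : ∀ j, b' j ≤ Function.update b' i (a i p) j := fun j => by
      by_cases hji : j = i
      · subst hji; simpa using hb
      · simp [hji]
    refine ⟨Function.update b' i (a i p), fun x hx => ?_, fun j hj => ?_, fun j hj => ?_⟩
    · by_cases hx' : ∀ j ∈ M, j ≠ i → a j x < b' j
      · exact ⟨i, hiM, by simpa using hpmin x ⟨hx, hx'⟩⟩
      · push Not at hx'
        obtain ⟨j, hjM, hji, hj⟩ := hx'
        exact ⟨j, hjM, by simpa [hji] using hj⟩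
    · obtain ⟨x, hx, hx'⟩ := h2 j hj
      exact ⟨x, hx, fun l hl hlj => (hx' l hl hlj).trans_le (hle l)⟩
    · by_cases hji : j = i
      · subst hji
        exact ⟨p, hpX, by simp, fun l hl hlj => (hp l hl hlj).trans_le (hle l)⟩
      · obtain ⟨x, hx, hxe, hx'⟩ := h3 j (Finset.mem_of_mem_insert_of_ne hj hji)
        exact ⟨x, hx, by simp [hji, hxe], fun l hl hlj => (hx' l hl hlj).trans_le (hle l)⟩

variable [Fintype κ]

/-- Bell's bound on the size of a minimal infeasible system of strict linear inequalities on a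
finite set that contains the midpoint of any two of its points with the same parity. -/
theorem card_le_of_minimal_infeasible (hX : X.Finite) (par : E → κ)
    (hpar : ∀ p ∈ X, ∀ q ∈ X, par p = par q → midpoint ℝ p q ∈ X)
    (M : Finset ι) (a : ι → E →ₗ[ℝ] ℝ) (b : ι → ℝ)
    (hempty : ∀ x ∈ X, ∃ i ∈ M, b i ≤ a i x)
    (hmin : ∀ i ∈ M, ∃ x ∈ X, ∀ j ∈ M, j ≠ i → a j x < b j) :
    M.card ≤ Fintype.card κ := by
  obtain ⟨b', h1, -, h3⟩ := exists_tight_relaxation hX M a b hempty hmin M subset_rfl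
  choose! p hpX hpe hp using h3
  by_contra! hcard
  obtain ⟨i, hi, j, hj, hij, he⟩ := Finset.exists_ne_map_eq_of_card_lt_of_maps_to
    (t := Finset.univ) (by simpa using hcard) (f := fun i => par (p i))
    (fun _ _ => Finset.mem_coe.2 (Finset.mem_univ _))
  obtain ⟨l, hl, hle⟩ := h1 _ (hpar _ (hpX i hi) _ (hpX j hj) he)
  have hmid : a l (midpoint ℝ (p i) (p j)) = (a l (p i) + a l (p j)) / 2 := by
    rw [midpoint_eq_smul_add, map_smul, map_add, invOf_eq_inv, smul_eq_mul]; ring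
  rw [hmid] at hle
  by_cases hli : l = i
  · subst hli
    linarith [hpe l hi, hp j hj l hl hij]
  · by_cases hlj : l = j
    · subst hlj
      linarith [hpe l hj, hp i hi l hl hli]
    · linarith [hp i hi l hl hli, hp j hj l hl hlj]

/-- An inclusion-minimal infeasible subsystem satisfies the hypotheses of Bell's bound. -/
theorem exists_small_infeasible (hX : X.Finite) (par : E → κ)
    (hpar : ∀ p ∈ X, ∀ q ∈ X, par p = par q → midpoint ℝ p q ∈ X)
    (M : Finset ι) (a : ι → E →ₗ[ℝ] ℝ) (b : ι → ℝ)
    (hempty : ∀ x ∈ X, ∃ i ∈ M, b i ≤ a i x) :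
    ∃ N ⊆ M, N.card ≤ Fintype.card κ ∧ ∀ x ∈ X, ∃ i ∈ N, b i ≤ a i x := by
  classical
  obtain ⟨N, hNM, hN⟩ := exists_minimal_le_of_wellFoundedLT
    (fun N : Finset ι => ∀ x ∈ X, ∃ i ∈ N, b i ≤ a i x) M hempty
  refine ⟨N, hNM, card_le_of_minimal_infeasible hX par hpar N a b hN.prop fun i hi => ?_, hN.prop⟩
  by_contra! hcon
  refine Finset.notMem_erase i N (hN.le_of_le (y := N.erase i) (fun x hx => ?_)
    (Finset.erase_subset _ _) hi)
  obtain ⟨j, hj, hji, hle⟩ := hcon x hx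
  exact ⟨j, Finset.mem_erase.2 ⟨hji, hj⟩, hle⟩

end Helly

/-! ### Helly numbers of finite sets, integer boxes and ℤ^d -/

theorem hellyCondition_of_finite {d : ℕ} {κ : Type*} [Fintype κ]
    {X : Set (EuclideanSpace ℝ (Fin d))} (hX : X.Finite) (par : EuclideanSpace ℝ (Fin d) → κ)
    (hpar : ∀ p ∈ X, ∀ q ∈ X, par p = par q → midpoint ℝ p q ∈ X) :
    HellyCondition {A | IsSConvex X A} (Fintype.card κ) := by
  classical
  intro m hm F hF hempty
  have hsep : ∀ x ∈ X, ∃ (i : Fin m) (a : EuclideanSpace ℝ (Fin d) →ₗ[ℝ] ℝ),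
      ∀ y ∈ F i, a y < a x := fun x hx => by
    obtain ⟨i, hi⟩ : ∃ i, x ∉ F i := by
      by_contra! h
      exact (hempty ▸ mem_iInter.2 h : x ∈ (∅ : Set _))
    obtain ⟨C, hC, hFC⟩ := hF i
    have hxC : x ∉ convexHull ℝ (F i) := fun h =>
      hi (hFC ▸ ⟨hx, convexHull_min (hFC ▸ inter_subset_right) hC h⟩)
    have hfin : (F i).Finite := hX.subset (hFC ▸ inter_subset_left)
    obtain ⟨f, u, h1, h2⟩ := geometric_hahn_banach_closed_point (convex_convexHull ℝ (F i))
      (hfin.isClosed_convexHull ℝ) hxC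
    exact ⟨i, f.toLinearMap, fun y hy => (h1 y (subset_convexHull ℝ _ hy)).trans h2⟩
  have : Nonempty (Fin m) := ⟨⟨0, hm⟩⟩
  choose! i a ha using hsep
  -- The system has one inequality `a x y < a x x` for each x in X. It is infeasible on X because x
  -- violates its own inequality, while all of `F (i x)` satisfies it.
  obtain ⟨N, hNsub, hN, hNX⟩ := exists_small_infeasible hX par hpar
    hX.toFinset a (fun x => a x x) (fun x hx => ⟨x, by simpa using hx, le_rfl⟩)
  obtain ⟨f, hf⟩ := exists_fin_tuple_range_superset (N.image i) (Finset.card_image_le.trans hN)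
  have hcov : ∀ x ∈ X, ∃ j, x ∉ F (f j) := fun x hx => by
    obtain ⟨y, hy, hle⟩ := hNX x hx
    obtain ⟨j, hj⟩ := hf (Finset.mem_coe.2 (Finset.mem_image_of_mem i hy))
    refine ⟨j, fun hxF => ?_⟩
    rw [hj] at hxF
    exact (ha y (by simpa using hNsub hy) x hxF).not_ge hle
  refine ⟨f, eq_empty_of_forall_notMem fun x hx => ?_⟩
  rw [mem_iInter] at hx
  by_cases hxX : x ∈ X
  · obtain ⟨j, hj⟩ := hcov x hxX
    exact hj (hx j)
  -- The tuple has at least one entry, since `par x` inhabits κ; an empty tuple would have the whole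
  -- space as intersection.
  · obtain ⟨C, -, hC⟩ := hF (f ⟨0, Fintype.card_pos_iff.2 ⟨par x⟩⟩)
    exact hxX (hC.subset (hx _)).1

theorem integerBox_finite (d t : ℕ) : (integerBox d t).Finite := by
  refine ((Set.finite_Icc (fun _ : Fin d => -(t : ℤ)) (fun _ => (t : ℤ))).image
    (fun z => WithLp.toLp 2 (fun i => (z i : ℝ)))).subset ?_
  rintro x ⟨hx, hxt⟩
  choose z hz using hx
  have hzt : ∀ i, -(t : ℤ) ≤ z i ∧ z i ≤ t := fun i => by
    have := hxt i
    rw [hz i, mem_Icc] at this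
    exact ⟨Int.cast_le (R := ℝ).1 (by simpa using this.1),
      Int.cast_le (R := ℝ).1 (by simpa using this.2)⟩
  refine ⟨z, ⟨fun i => (hzt i).1, fun i => (hzt i).2⟩, ?_⟩
  ext i
  simp [hz i]

theorem integerBox_mono (d : ℕ) : Monotone (integerBox d) := fun s t hst x hx =>
  ⟨hx.1, fun i => by
    have h : (s : ℝ) ≤ t := by exact_mod_cast hst
    exact ⟨by linarith [(hx.2 i).1], (hx.2 i).2.trans h⟩⟩

theorem iUnion_integerBox (d : ℕ) : ⋃ t, integerBox d t = integerPoints d := by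
  refine subset_antisymm (iUnion_subset fun t => inter_subset_left) fun x hx => ?_
  obtain ⟨t, ht⟩ := exists_nat_ge (∑ i, |x i|)
  refine mem_iUnion.2 ⟨t, hx, fun i => abs_le.1 (le_trans ?_ ht)⟩
  exact Finset.single_le_sum (f := fun i => |x i|) (fun _ _ => abs_nonneg _) (Finset.mem_univ i)

theorem convex_coordBox {d : ℕ} (a b : ℝ) :
    Convex ℝ {x : EuclideanSpace ℝ (Fin d) | ∀ i, x i ∈ Icc a b} := by
  rw [ofPred_forall]
  exact convex_iInter fun i =>
    (convex_Icc a b).is_linear_preimage ⟨fun _ _ => rfl, fun _ _ => rfl⟩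

/-- The coordinatewise parity of a point of `ℤ^d`. -/
noncomputable def parity {d : ℕ} (x : EuclideanSpace ℝ (Fin d)) : Fin d → ZMod 2 :=
  fun i => (⌊x i⌋ : ZMod 2)

theorem midpoint_mem_integerBox {d t : ℕ} {p q : EuclideanSpace ℝ (Fin d)}
    (hp : p ∈ integerBox d t) (hq : q ∈ integerBox d t) (h : parity p = parity q) :
    midpoint ℝ p q ∈ integerBox d t := by
  refine ⟨fun i => ?_, (convex_coordBox _ _).midpoint_mem hp.2 hq.2⟩
  obtain ⟨m, hm⟩ := hp.1 i
  obtain ⟨n, hn⟩ := hq.1 i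
  have hi := congrFun h i
  simp only [parity, hm, hn, Int.floor_intCast] at hi
  obtain ⟨l, hl⟩ := (ZMod.intCast_eq_intCast_iff_dvd_sub _ _ 2).1 hi
  refine ⟨m + l, ?_⟩
  have hl' : (n : ℝ) - m = 2 * l := by exact_mod_cast hl
  rw [midpoint_eq_smul_add]
  simp [hm, hn]
  linarith

theorem hellyCondition_integerBox (d t : ℕ) :
    HellyCondition {A | IsSConvex (integerBox d t) A} (2 ^ d) := by
  have h := hellyCondition_of_finite (integerBox_finite d t) parity
    fun p hp q hq hpq => midpoint_mem_integerBox hp hq hpq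
  simpa [ZMod.card] using h

/-- Doignon's theorem. -/
theorem hellyCondition_integerPoints (d : ℕ) :
    HellyCondition {A | IsSConvex (integerPoints d) A} (2 ^ d) := by
  intro m hm F hF hempty
  by_contra! hcon
  choose p hp using hcon
  have hpt : ∀ f : Fin (2 ^ d) → Fin m, ∃ t, p f ∈ integerBox d t := fun f => by
    obtain ⟨C, -, hC⟩ := hF (f ⟨0, by positivity⟩)
    rw [← mem_iUnion, iUnion_integerBox]
    exact (hC.subset (mem_iInter.1 (hp f) _)).1
  choose t ht using hpt
  -- There are finitely many tuples, so one box contains all the witnesses; the traces of the family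
  -- on it contradict the Helly property of the box.
  have hbox : ∀ f, p f ∈ integerBox d (Finset.univ.sup t) := fun f =>
    integerBox_mono d (Finset.le_sup (Finset.mem_univ f)) (ht f)
  have : Nonempty (Fin m) := ⟨⟨0, hm⟩⟩
  obtain ⟨f, hf⟩ := hellyCondition_integerBox d (Finset.univ.sup t) m hm
    (fun i => F i ∩ integerBox d (Finset.univ.sup t))
    (fun i => by
      obtain ⟨C, hC, hFC⟩ := hF i
      refine ⟨C, hC, ?_⟩
      rw [hFC, inter_right_comm, integerBox, ← inter_assoc, inter_self])
    (by rw [← iInter_inter, hempty, empty_inter])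
  exact (hf ▸ mem_iInter.2 fun j => ⟨mem_iInter.1 (hp f) j, hbox f⟩ : p f ∈ (∅ : Set _))

/-! ### Facets of polyhedra given by k inequalities -/

section Facet

variable {d k : ℕ}

/-- The polyhedron of points with `⟨v i, x - c⟩ ≤ 1` for all `i`. -/
def polarPolyhedron (v : Fin k → EuclideanSpace ℝ (Fin d)) (c : EuclideanSpace ℝ (Fin d)) :
    Set (EuclideanSpace ℝ (Fin d)) :=
  {x | ∀ i, inner ℝ (v i) (x - c) ≤ 1}

theorem isPolyhedron_polarPolyhedron (v : Fin k → EuclideanSpace ℝ (Fin d))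
    (c : EuclideanSpace ℝ (Fin d)) : IsPolyhedron (polarPolyhedron v c) := by
  refine ⟨k, v, fun i => 1 + inner ℝ (v i) c, ?_⟩
  ext x
  simp only [polarPolyhedron, mem_ofPred_eq, inner_sub_right, sub_le_iff_le_add]

theorem isClosed_polarPolyhedron (v : Fin k → EuclideanSpace ℝ (Fin d))
    (c : EuclideanSpace ℝ (Fin d)) : IsClosed (polarPolyhedron v c) := by
  simp only [polarPolyhedron, ofPred_forall]
  exact isClosed_iInter fun i => isClosed_le (by fun_prop) continuous_const

theorem convex_polarPolyhedron (v : Fin k → EuclideanSpace ℝ (Fin d))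
    (c : EuclideanSpace ℝ (Fin d)) : Convex ℝ (polarPolyhedron v c) := by
  intro x hx y hy a b ha hb hab i
  have h : a • x + b • y - c = a • (x - c) + b • (y - c) := by
    have h1 : c = a • c + b • c := by rw [← add_smul, hab, one_smul]
    rw [smul_sub, smul_sub, ← add_sub_add_comm, ← h1]
  rw [h, inner_add_right, inner_smul_right, inner_smul_right]
  nlinarith [mul_le_mul_of_nonneg_left (hx i) ha, mul_le_mul_of_nonneg_left (hy i) hb]

theorem mem_interior_polarPolyhedron {v : Fin k → EuclideanSpace ℝ (Fin d)}
    {c x : EuclideanSpace ℝ (Fin d)} :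
    x ∈ interior (polarPolyhedron v c) ↔ ∀ i, inner ℝ (v i) (x - c) < 1 := by
  constructor
  · intro hx i
    -- A small move along `v i` stays in the polyhedron but strictly increases the i-th form when `v
    -- i ≠ 0`.
    have hline : Tendsto (fun ε : ℝ => x + ε • v i) (nhdsWithin 0 (Ioi 0)) (nhds x) := by
      have : Continuous fun ε : ℝ => x + ε • v i := by fun_prop
      simpa using (this.tendsto 0).mono_left nhdsWithin_le_nhds
    obtain ⟨ε, hε, hε0⟩ := ((hline.eventually (mem_interior_iff_mem_nhds.1 hx)).and
      self_mem_nhdsWithin).exists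
    have h := hε i
    rw [add_sub_right_comm, inner_add_right, inner_smul_right, real_inner_self_eq_norm_sq] at h
    by_cases hv : v i = 0
    · simp [hv]
    · have : 0 < ε * ‖v i‖ ^ 2 := mul_pos hε0 (by positivity)
      linarith
  · intro hx
    refine interior_maximal (s := polarPolyhedron v c)
      (t := {x | ∀ i, inner ℝ (v i) (x - c) < 1}) (fun y hy i => (hy i).le) ?_ hx
    rw [ofPred_forall]
    exact isOpen_iInter_of_finite fun i => isOpen_lt (by fun_prop) continuous_const

theorem eq_zero_of_isMaxOn_interior {P : Set (EuclideanSpace ℝ (Fin d))}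
    {l : StrongDual ℝ (EuclideanSpace ℝ (Fin d))} {p : EuclideanSpace ℝ (Fin d)}
    (hp : p ∈ interior P) (hl : ∀ y ∈ P, l y ≤ l p) : l = 0 := by
  have hmax : IsLocalMax l p := by
    filter_upwards [mem_interior_iff_mem_nhds.1 hp] with y hy using hl y hy
  exact (l.hasFDerivAt (x := p)).unique (hmax.hasFDerivAt_eq_zero l.hasFDerivAt ▸ l.hasFDerivAt)

theorem vectorSpan_eq_top_of_interior {P : Set (EuclideanSpace ℝ (Fin d))}
    (hP : (interior P).Nonempty) : vectorSpan ℝ P = ⊤ := by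
  rw [← direction_affineSpan, affineSpan_eq_top_of_nonempty_interior
    (hP.mono (interior_mono (subset_convexHull ℝ P))) , AffineSubspace.direction_top]

/-- A facet cannot meet the interior, so some inequality is tight on all of it; a dimension count
then shows that the facet is the entire tight face. -/
theorem IsFacet.exists_eq {v : Fin k → EuclideanSpace ℝ (Fin d)} {c : EuclideanSpace ℝ (Fin d)}
    {F : Set (EuclideanSpace ℝ (Fin d))} (hk : 1 ≤ k)
    (hF : IsFacet (polarPolyhedron v c) F) :
    ∃ i, F = {x ∈ polarPolyhedron v c | inner ℝ (v i) (x - c) = 1} := by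
  obtain ⟨hexp, hne, hdim⟩ := hF
  obtain ⟨l, hl⟩ := hexp hne
  have hint : c ∈ interior (polarPolyhedron v c) :=
    mem_interior_polarPolyhedron.2 fun i => by simp
  rw [vectorSpan_eq_top_of_interior ⟨c, hint⟩, finrank_top, finrank_euclideanSpace_fin]
    at hdim
  have hFconv : Convex ℝ F := by
    exact hexp.convex (convex_polarPolyhedron v c)
  have hFP : F ⊆ polarPolyhedron v c := hexp.subset
  have hex : ∃ i, ∀ x ∈ F, inner ℝ (v i) (x - c) = 1 := by
    -- Otherwise pick for each i a point of F with slack in inequality i. Their average is interior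
    -- and lies in F, so the exposing functional vanishes and F is the whole polyhedron.
    by_contra! hcon
    choose x hxF hx using hcon
    have hk' : (k : ℝ) ≠ 0 := by positivity
    have hmem : ∑ j, (1 / k : ℝ) • x j ∈ F :=
      hFconv.sum_mem (fun _ _ => by positivity) (by simp [hk']) fun j _ => hxF j
    have hmem' : ∑ j, (1 / k : ℝ) • x j ∈ interior (polarPolyhedron v c) := by
      refine mem_interior_polarPolyhedron.2 fun i => ?_
      have h1 : ∑ j, (1 / k : ℝ) • x j - c = ∑ j, (1 / k : ℝ) • (x j - c) := by
        simp only [smul_sub, Finset.sum_sub_distrib]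
        simp [← Nat.cast_smul_eq_nsmul ℝ, smul_smul, hk']
      have h2 : (1 : ℝ) = ∑ j : Fin k, (1 / k : ℝ) * 1 := by simp [hk']
      rw [h1, inner_sum]
      simp only [inner_smul_right]
      refine lt_of_lt_of_eq ?_ h2.symm
      have hk0 : (0 : ℝ) < 1 / k := by positivity
      exact Finset.sum_lt_sum
        (fun j _ => mul_le_mul_of_nonneg_left (hFP (hxF j) i) hk0.le)
        ⟨i, Finset.mem_univ _, mul_lt_mul_of_pos_left (lt_of_le_of_ne (hFP (hxF i) i) (hx i)) hk0⟩
    rw [hl] at hmem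
    have hl0 := eq_zero_of_isMaxOn_interior hmem' hmem.2
    have hFeq : F = polarPolyhedron v c := by rw [hl, hl0]; simp
    rw [hFeq, vectorSpan_eq_top_of_interior ⟨c, hint⟩, finrank_top,
      finrank_euclideanSpace_fin] at hdim
    omega
  obtain ⟨i, hi⟩ := hex
  refine ⟨i, subset_antisymm (fun x hx => ⟨hFP hx, hi x hx⟩) fun y hy => ?_⟩
  obtain ⟨x₀, hx₀⟩ := hne
  have hker : vectorSpan ℝ F ≤ (innerSL ℝ (v i)).toLinearMap.ker := by
    refine Submodule.span_le.2 ?_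
    rintro _ ⟨p, hp, q, hq, rfl⟩
    have : p - q = (p - c) - (q - c) := by abel
    simp only [vsub_eq_sub, SetLike.mem_coe, LinearMap.mem_ker, ContinuousLinearMap.coe_coe,
      innerSL_apply_apply]
    rw [this, inner_sub_right, hi p hp, hi q hq, sub_self]
  have hlker : vectorSpan ℝ F ≤ l.toLinearMap.ker := by
    refine Submodule.span_le.2 ?_
    rintro _ ⟨p, hp, q, hq, rfl⟩
    rw [hl] at hp hq
    simp [le_antisymm (hp.2 q hq.1) (hq.2 p hp.1)]
  have hne_top : (innerSL ℝ (v i)).toLinearMap.ker ≠ ⊤ := fun h => by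
    have : x₀ - c ∈ (innerSL ℝ (v i)).toLinearMap.ker := h ▸ Submodule.mem_top
    have h1 : inner ℝ (v i) (x₀ - c) = 0 := by simpa using this
    linarith [hi x₀ hx₀]
  have hlt := Submodule.finrank_lt hne_top
  rw [finrank_euclideanSpace_fin] at hlt
  -- Both spaces have dimension d - 1, so the exposing functional vanishes on the kernel and is
  -- constant on the tight face.
  have heq := Submodule.eq_of_le_of_finrank_le hker (by omega)
  have hmem : y - x₀ ∈ vectorSpan ℝ F := by
    rw [heq]
    have : y - x₀ = (y - c) - (x₀ - c) := by abel
    simp only [LinearMap.mem_ker, ContinuousLinearMap.coe_coe, innerSL_apply_apply]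
    rw [this, inner_sub_right, hy.2, hi x₀ hx₀, sub_self]
  have hly : l y = l x₀ := by
    have := hlker hmem
    simpa [sub_eq_zero] using this
  rw [hl] at hx₀ ⊢
  exact ⟨hy.1, fun z hz => hly ▸ hx₀.2 z hz⟩

theorem encard_facets_polarPolyhedron_le (v : Fin k → EuclideanSpace ℝ (Fin d))
    (c : EuclideanSpace ℝ (Fin d)) (hk : 1 ≤ k) :
    {F | IsFacet (polarPolyhedron v c) F}.encard ≤ k := by
  have hsub : {F | IsFacet (polarPolyhedron v c) F} ⊆
      (fun i => {x ∈ polarPolyhedron v c | inner ℝ (v i) (x - c) = 1}) '' univ := fun F hF => by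
    obtain ⟨i, hi⟩ := IsFacet.exists_eq hk hF
    exact ⟨i, mem_univ _, hi.symm⟩
  refine (encard_le_encard hsub).trans ((encard_image_le _ _).trans ?_)
  simp

end Facet

/-! ### Compactness of the polar and the facet bound -/

section UpperBound

variable {d k : ℕ}

/-- The polar of `L` with respect to the point `c`. -/
def polarAt (L : Set (EuclideanSpace ℝ (Fin d))) (c : EuclideanSpace ℝ (Fin d)) :
    Set (EuclideanSpace ℝ (Fin d)) :=
  {v | ∀ x ∈ L, inner ℝ v (x - c) ≤ 1}

theorem isCompact_polarAt {L : Set (EuclideanSpace ℝ (Fin d))} {c : EuclideanSpace ℝ (Fin d)}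
    (hc : c ∈ interior L) : IsCompact (polarAt L c) := by
  obtain ⟨r, hr, hball⟩ := Metric.nhds_basis_closedBall.mem_iff.1 (mem_interior_iff_mem_nhds.1 hc)
  refine Metric.isCompact_of_isClosed_isBounded ?_
    ((Metric.isBounded_closedBall (x := 0) (r := r⁻¹)).subset fun v hv => ?_)
  · simp only [polarAt, ofPred_forall]
    exact isClosed_biInter fun x _ => isClosed_le (by fun_prop) continuous_const
  · rw [mem_closedBall_zero_iff]
    by_cases hv0 : v = 0
    · simp [hv0, hr.le]
    have hvn : 0 < ‖v‖ := norm_pos_iff.2 hv0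
    have h := hv (c + (r / ‖v‖) • v) (hball (by
      simp [norm_smul, abs_of_pos hr, hvn.ne']))
    rw [add_sub_cancel_left, inner_smul_right, real_inner_self_eq_norm_sq] at h
    have h2 : r / ‖v‖ * ‖v‖ ^ 2 = r * ‖v‖ := by field_simp
    rw [h2] at h
    rw [← one_div, le_div_iff₀ hr]
    linarith

/-- Separate z from the open convex set `interior L` and scale the functional to take the value 1 at
`z - c`. -/
theorem exists_mem_polarAt {L : Set (EuclideanSpace ℝ (Fin d))} {c z : EuclideanSpace ℝ (Fin d)}
    (hL : Convex ℝ L) (hc : c ∈ interior L) (hz : z ∉ interior L) :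
    ∃ v ∈ polarAt L c, 1 ≤ inner ℝ v (z - c) := by
  obtain ⟨f, hf⟩ := geometric_hahn_banach_open_point hL.interior isOpen_interior hz
  have hpos : 0 < f (z - c) := by rw [map_sub]; linarith [hf c hc]
  have hf' : ∀ x ∈ L, f x ≤ f z := fun x hx => by
    have hcl : closure (interior L) ⊆ {x | f x ≤ f z} :=
      closure_minimal (fun y hy => (hf y hy).le) (isClosed_le f.continuous continuous_const)
    exact hcl ((hL.closure_interior_eq_closure_of_nonempty_interior ⟨c, hc⟩).symm ▸
      subset_closure hx)
  have hin : ∀ y, inner ℝ ((f (z - c))⁻¹ • (InnerProductSpace.toDual ℝ _).symm f) y =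
      (f (z - c))⁻¹ * f y := fun y => by
    rw [inner_smul_left, InnerProductSpace.toDual_symm_apply]; simp
  refine ⟨(f (z - c))⁻¹ • (InnerProductSpace.toDual ℝ _).symm f, fun x hx => ?_, ?_⟩
  · rw [hin, inv_mul_le_iff₀ hpos, mul_one, map_sub, map_sub]
    linarith [hf' x hx]
  · rw [hin, inv_mul_cancel₀ hpos.ne']

theorem convex_inner_sub_lt (v c : EuclideanSpace ℝ (Fin d)) (r : ℝ) :
    Convex ℝ {x | inner ℝ v (x - c) < r} := by
  have hset : {x | inner ℝ v (x - c) < r} = {x | innerSL ℝ v x < r + inner ℝ v c} := by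
    ext x
    simp [inner_sub_right, sub_lt_iff_lt_add]
  rw [hset]
  exact convex_halfSpace_lt (innerSL ℝ v).toLinearMap.isLinear _

/-- Each z in T is excluded from the open half-space of its own separating vector, so these
half-spaces have no common point in T; the Helly condition keeps k of them. -/
theorem exists_polarAt_tuple {L T : Set (EuclideanSpace ℝ (Fin d))}
    {c : EuclideanSpace ℝ (Fin d)} (hL : Convex ℝ L) (hc : c ∈ interior L)
    (hT : T.Finite) (hLT : Disjoint (interior L) T) (hH : HellyCondition {A | IsSConvex T A} k) :
    ∃ v : Fin k → EuclideanSpace ℝ (Fin d), (∀ i, v i ∈ polarAt L c) ∧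
      ∀ z ∈ T, ∃ i, 1 ≤ inner ℝ (v i) (z - c) := by
  have hsep : ∀ z : T, ∃ v ∈ polarAt L c, 1 ≤ inner ℝ v (z - c) := fun z =>
    exists_mem_polarAt hL hc fun h => hLT.notMem_of_mem_left h z.2
  choose w hwL hw using hsep
  rcases T.eq_empty_or_nonempty with rfl | hTne
  · exact ⟨fun _ => 0, fun _ x _ => by simp, by simp⟩
  have := hT.fintype
  have : Nonempty T := hTne.to_subtype
  let e := Fintype.equivFin T
  obtain ⟨f, hf⟩ := hH (Fintype.card T) Fintype.card_pos
    (fun j => T ∩ {x | inner ℝ (w (e.symm j)) (x - c) < 1})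
    (fun j => ⟨_, convex_inner_sub_lt _ _ _, rfl⟩) <| by
      refine eq_empty_of_forall_notMem fun z hz => ?_
      rw [mem_iInter] at hz
      have hzT : z ∈ T := (hz ⟨0, Fintype.card_pos⟩).1
      have h := (hz (e ⟨z, hzT⟩)).2
      simp only [Equiv.symm_apply_apply, mem_ofPred_eq] at h
      exact h.not_ge (hw ⟨z, hzT⟩)
  refine ⟨fun i => w (e.symm (f i)), fun i => hwL _, fun z hz => ?_⟩
  by_contra! hcon
  exact (hf ▸ mem_iInter.2 fun i => ⟨hz, hcon i⟩ : z ∈ (∅ : Set _))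

/-- If `S` is the increasing union of finite sets whose convexity spaces have Helly number at most
`k`, then every full-dimensional maximal `S`-free set is a polyhedron with at most `k` facets. -/
theorem facetBound_of_exhaustion {S : Set (EuclideanSpace ℝ (Fin d))}
    (T : ℕ → Set (EuclideanSpace ℝ (Fin d))) (hmono : Monotone T) (hfin : ∀ n, (T n).Finite)
    (hS : ⋃ n, T n = S) (hk : 1 ≤ k) (hH : ∀ n, HellyCondition {A | IsSConvex (T n) A} k) :
    FacetBound S k := by
  intro L hLmax hdim
  obtain ⟨⟨hclosed, hconv, hdisj⟩, hmax⟩ := hLmax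
  obtain ⟨c, hc⟩ := (hconv.interior_nonempty_iff_affineSpan_eq_top).2 hdim
  -- The sets `K n` are nonempty, compact and decreasing; a tuple in all of them cuts off every
  -- point of S.
  let K : ℕ → Set (Fin k → EuclideanSpace ℝ (Fin d)) := fun n =>
    (univ.pi fun _ => polarAt L c) ∩ {v | ∀ z ∈ T n, ∃ i, 1 ≤ inner ℝ (v i) (z - c)}
  have hcomp : IsCompact (univ.pi fun _ : Fin k => polarAt L c) :=
    isCompact_univ_pi fun _ => isCompact_polarAt hc
  have hKcl : ∀ n, IsClosed {v : Fin k → EuclideanSpace ℝ (Fin d) |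
      ∀ z ∈ T n, ∃ i, 1 ≤ inner ℝ (v i) (z - c)} := fun n => by
    simp only [ofPred_forall, ofPred_exists]
    exact isClosed_biInter fun z _ => isClosed_iUnion_of_finite fun i =>
      isClosed_le continuous_const (by fun_prop)
  obtain ⟨v, hv⟩ := IsCompact.nonempty_iInter_of_sequence_nonempty_isCompact_isClosed K
    (fun n v hv => ⟨hv.1, fun z hz => hv.2 z (hmono n.le_succ hz)⟩)
    (fun n => by
      obtain ⟨v, h1, h2⟩ := exists_polarAt_tuple hconv hc (hfin n)
        (hdisj.mono_right (hS ▸ subset_iUnion T n)) (hH n)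
      exact ⟨v, fun i _ => h1 i, h2⟩)
    (hcomp.inter_right (hKcl 0)) (fun n => hcomp.isClosed.inter (hKcl n))
  rw [mem_iInter] at hv
  have hsub : L ⊆ polarPolyhedron v c := fun x hx i => (hv 0).1 i (mem_univ _) x hx
  have hfree : IsSFree S (polarPolyhedron v c) := by
    refine ⟨isClosed_polarPolyhedron v c, convex_polarPolyhedron v c,
      disjoint_left.2 fun z hz hzS => ?_⟩
    obtain ⟨n, hn⟩ := mem_iUnion.1 (hS ▸ hzS : z ∈ ⋃ n, T n)
    obtain ⟨i, hi⟩ := (hv n).2 z hn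
    exact hi.not_gt (mem_interior_polarPolyhedron.1 hz i)
  have heq : L = polarPolyhedron v c := by
    by_contra hne
    exact hmax _ hfree (hsub.ssubset_of_ne hne)
  rw [heq]
  exact ⟨isPolyhedron_polarPolyhedron v c, encard_facets_polarPolyhedron_le v c hk⟩

end UpperBound

theorem facetBound_integerPoints (d : ℕ) : FacetBound (integerPoints d) (2 ^ d) :=
  facetBound_of_exhaustion (integerBox d) (integerBox_mono d) (integerBox_finite d)
    (iUnion_integerBox d) Nat.one_le_two_pow (hellyCondition_integerBox d)

theorem facetBound_integerBox (d t : ℕ) : FacetBound (integerBox d t) (2 ^ d) :=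
  facetBound_of_exhaustion (fun _ => integerBox d t) monotone_const
    (fun _ => integerBox_finite d t) (iUnion_const _) Nat.one_le_two_pow
    (fun _ => hellyCondition_integerBox d t)

/-! ### Sign vectors of the cube and the ℓ¹-norm -/

section Cube

variable {d : ℕ}

/-- The centre of the unit cube. -/
noncomputable def cubeCenter (d : ℕ) : EuclideanSpace ℝ (Fin d) := WithLp.toLp 2 fun _ => 1 / 2

/-- The vector of signs that points from the centre of the unit cube to the vertex `z`. -/
noncomputable def cubeSign (z : EuclideanSpace ℝ (Fin d)) : EuclideanSpace ℝ (Fin d) :=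
  WithLp.toLp 2 fun i => 2 * z i - 1

/-- The vertex of the unit cube with the given coordinates. -/
noncomputable def cubeVertex (b : Fin d → Bool) : EuclideanSpace ℝ (Fin d) :=
  WithLp.toLp 2 fun i => if b i then 1 else 0

theorem cubeVertex_injective : Function.Injective (cubeVertex (d := d)) := by
  intro b b' h
  ext i
  have hi := congrArg (fun x : EuclideanSpace ℝ (Fin d) => x i) h
  simp only [cubeVertex] at hi
  cases hb : b i <;> cases hb' : b' i <;> simp [hb, hb'] at hi ⊢

theorem range_cubeVertex : range (cubeVertex (d := d)) = cubeVertices d := by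
  classical
  ext x
  constructor
  · rintro ⟨b, rfl⟩ i
    cases hb : b i <;> simp [cubeVertex, hb]
  · intro hx
    refine ⟨fun i => decide (x i = 1), ?_⟩
    ext i
    rcases hx i with h | h <;> simp [cubeVertex, h]

theorem encard_cubeVertices : (cubeVertices d).encard = ((2 ^ d : ℕ) : ℕ∞) := by
  rw [← range_cubeVertex, ← image_univ, cubeVertex_injective.injOn.encard_image, encard_univ]
  simp

theorem cubeVertices_nonempty : (cubeVertices d).Nonempty := ⟨0, fun _ => Or.inl rfl⟩

theorem cubeVertices_subset_integerPoints : cubeVertices d ⊆ integerPoints d := fun x hx i => by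
  rcases hx i with h | h
  · exact ⟨0, by simp [h]⟩
  · exact ⟨1, by simp [h]⟩

theorem cubeVertices_subset_integerBox {t : ℕ} (ht : 1 ≤ t) :
    cubeVertices d ⊆ integerBox d t := fun x hx =>
  ⟨cubeVertices_subset_integerPoints hx, fun i => by
    have : (1 : ℝ) ≤ t := by exact_mod_cast ht
    rcases hx i with h | h <;> rw [h, mem_Icc] <;> constructor <;> linarith⟩

theorem inner_cubeSign (z x : EuclideanSpace ℝ (Fin d)) :
    inner ℝ (cubeSign z) (x - cubeCenter d) = ∑ i, (2 * z i - 1) * (x i - 1 / 2) := by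
  simp [cubeSign, cubeCenter, PiLp.inner_apply, mul_comm]

theorem inner_cubeSign_le {z : EuclideanSpace ℝ (Fin d)} (hz : z ∈ cubeVertices d)
    (x : EuclideanSpace ℝ (Fin d)) :
    inner ℝ (cubeSign z) (x - cubeCenter d) ≤ ∑ i, |x i - 1 / 2| := by
  rw [inner_cubeSign]
  refine Finset.sum_le_sum fun i _ => ?_
  rcases hz i with h | h <;> rw [h]
  · linarith [neg_le_abs (x i - 1 / 2)]
  · linarith [le_abs_self (x i - 1 / 2)]

theorem exists_inner_cubeSign_eq (x : EuclideanSpace ℝ (Fin d)) :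
    ∃ z ∈ cubeVertices d, inner ℝ (cubeSign z) (x - cubeCenter d) = ∑ i, |x i - 1 / 2| := by
  classical
  refine ⟨cubeVertex fun i => decide (1 / 2 ≤ x i), range_cubeVertex ▸ mem_range_self _, ?_⟩
  rw [inner_cubeSign]
  refine Finset.sum_congr rfl fun i _ => ?_
  by_cases h : 1 / 2 ≤ x i
  · rw [abs_of_nonneg (by linarith)]
    simp only [cubeVertex, h, decide_true, if_true]
    ring
  · rw [abs_of_neg (by linarith)]
    simp only [cubeVertex, h, decide_false]
    norm_num

/-- Near z the signs of the coordinates of `y - cubeCenter d` do not change, so the ℓ¹-norm is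
linear there. This local linearity gives both maximality and the dimension of the facets. -/
theorem eventually_inner_cubeSign_eq {z : EuclideanSpace ℝ (Fin d)} (hz : z ∈ cubeVertices d) :
    ∀ᶠ y in nhds z, inner ℝ (cubeSign z) (y - cubeCenter d) = ∑ i, |y i - 1 / 2| := by
  have hnear : ∀ᶠ y in nhds z, ∀ i, |y i - z i| < 1 / 2 := by
    refine eventually_all.2 fun i => ?_
    have hcont : Continuous fun y : EuclideanSpace ℝ (Fin d) => |y i - z i| := by fun_prop
    exact hcont.continuousAt.eventually_lt continuousAt_const (by simp)
  filter_upwards [hnear] with y hy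
  rw [inner_cubeSign]
  refine Finset.sum_congr rfl fun i _ => ?_
  have := abs_lt.1 (hy i)
  rcases hz i with h | h <;> rw [h] at this ⊢
  · rw [abs_of_neg (by linarith)]; ring
  · rw [abs_of_pos (by linarith)]; ring

theorem inner_cubeSign_self {z : EuclideanSpace ℝ (Fin d)} (hz : z ∈ cubeVertices d) :
    inner ℝ (cubeSign z) (z - cubeCenter d) = (d : ℝ) / 2 := by
  have h : ∀ i, (2 * z i - 1) * (z i - 1 / 2) = 1 / 2 := fun i => by
    rcases hz i with h | h <;> rw [h] <;> norm_num
  rw [inner_cubeSign, Finset.sum_congr rfl fun i _ => h i]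
  simp [div_eq_mul_inv]

theorem inner_cubeSign_lt {z y : EuclideanSpace ℝ (Fin d)} (hz : z ∈ cubeVertices d)
    (hy : y ∈ cubeVertices d) (hne : y ≠ z) :
    inner ℝ (cubeSign z) (y - cubeCenter d) < (d : ℝ) / 2 := by
  obtain ⟨i, hi⟩ : ∃ i, y i ≠ z i := by
    by_contra! h
    exact hne (by ext i; exact h i)
  rw [← inner_cubeSign_self hz, inner_cubeSign, inner_cubeSign]
  refine Finset.sum_lt_sum (fun j _ => ?_) ⟨i, Finset.mem_univ _, ?_⟩
  · rcases hz j with h | h <;> rcases hy j with h' | h' <;> rw [h, h'] <;> norm_num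
  · rcases hz i with h | h <;> rcases hy i with h' | h' <;> rw [h, h'] at hi ⊢ <;>
      first | exact absurd rfl hi | norm_num

/-! ### The extremal maximal free set -/

/-- The cross-polytope circumscribed about the unit cube. -/
def crossPolytope (d : ℕ) : Set (EuclideanSpace ℝ (Fin d)) :=
  {x | ∑ i, |x i - 1 / 2| ≤ (d : ℝ) / 2}

theorem crossPolytope_eq : crossPolytope d =
    ⋂ z ∈ cubeVertices d, {x | inner ℝ (cubeSign z) (x - cubeCenter d) ≤ (d : ℝ) / 2} := by
  ext x
  simp only [mem_iInter, mem_ofPred_eq]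
  refine ⟨fun hx z hz => (inner_cubeSign_le hz x).trans hx, fun h => ?_⟩
  obtain ⟨z, hz, he⟩ := exists_inner_cubeSign_eq x
  exact he.symm.le.trans (h z hz)

theorem isClosed_crossPolytope : IsClosed (crossPolytope d) :=
  isClosed_le (by fun_prop) continuous_const

theorem convex_crossPolytope : Convex ℝ (crossPolytope d) := by
  rw [crossPolytope_eq]
  refine convex_iInter₂ fun z _ => ?_
  have hset : {x | inner ℝ (cubeSign z) (x - cubeCenter d) ≤ (d : ℝ) / 2} =
      {x | innerSL ℝ (cubeSign z) x ≤ d / 2 + inner ℝ (cubeSign z) (cubeCenter d)} := by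
    ext x
    simp [inner_sub_right]
  rw [hset]
  exact convex_halfSpace_le (innerSL ℝ (cubeSign z)).toLinearMap.isLinear _

theorem interior_crossPolytope (hd : 1 ≤ d) :
    interior (crossPolytope d) = {x | ∑ i, |x i - 1 / 2| < (d : ℝ) / 2} := by
  refine subset_antisymm (fun x hx => ?_)
    (interior_maximal (fun x hx => le_of_lt (mem_ofPred_eq ▸ hx))
    (isOpen_lt (by fun_prop) continuous_const))
  -- Dilation from the centre multiplies the ℓ¹-distance by 1 + ε, so a point with the positive
  -- value d/2 would leave the polytope.
  have hline : Tendsto (fun ε : ℝ => x + ε • (x - cubeCenter d)) (nhdsWithin 0 (Ioi 0))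
      (nhds x) := by
    have : Continuous fun ε : ℝ => x + ε • (x - cubeCenter d) := by fun_prop
    simpa using (this.tendsto 0).mono_left nhdsWithin_le_nhds
  obtain ⟨ε, hε, hε0⟩ := ((hline.eventually (mem_interior_iff_mem_nhds.1 hx)).and
    self_mem_nhdsWithin).exists
  replace hε0 : 0 < ε := hε0
  have hsum : ∑ i, |(x + ε • (x - cubeCenter d)) i - 1 / 2| = (1 + ε) * ∑ i, |x i - 1 / 2| := by
    rw [Finset.mul_sum]
    refine Finset.sum_congr rfl fun i _ => ?_
    rw [← abs_of_pos (show 0 < 1 + ε by linarith), ← abs_mul]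
    congr 1
    simp [cubeCenter]
    ring
  have h : ∑ i, |(x + ε • (x - cubeCenter d)) i - 1 / 2| ≤ (d : ℝ) / 2 := hε
  rw [hsum] at h
  have hd' : (1 : ℝ) ≤ d := by exact_mod_cast hd
  change ∑ i, |x i - 1 / 2| < (d : ℝ) / 2
  by_contra! hcon
  nlinarith

theorem isSFree_crossPolytope (hd : 1 ≤ d) {S : Set (EuclideanSpace ℝ (Fin d))}
    (hS : S ⊆ integerPoints d) : IsSFree S (crossPolytope d) := by
  refine ⟨isClosed_crossPolytope, convex_crossPolytope, disjoint_left.2 fun x hx hxS => ?_⟩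
  rw [interior_crossPolytope hd, mem_ofPred_eq] at hx
  refine not_le.2 hx ?_
  have h : ∀ i, (1 / 2 : ℝ) ≤ |x i - 1 / 2| := fun i => by
    obtain ⟨n, hn⟩ := hS hxS i
    rw [hn, le_abs]
    rcases le_or_gt n 0 with h | h
    · have : (n : ℝ) ≤ 0 := by exact_mod_cast h
      right; linarith
    · have : (1 : ℝ) ≤ n := by exact_mod_cast h
      left; linarith
  calc (d : ℝ) / 2 = ∑ _i : Fin d, (1 / 2 : ℝ) := by simp [div_eq_mul_inv]
    _ ≤ _ := Finset.sum_le_sum fun i _ => h i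

theorem isMaximalSFree_crossPolytope (hd : 1 ≤ d) {S : Set (EuclideanSpace ℝ (Fin d))}
    (hS : S ⊆ integerPoints d) (hcube : cubeVertices d ⊆ S) :
    IsMaximalSFree S (crossPolytope d) := by
  refine ⟨isSFree_crossPolytope hd hS, fun K hK hss => ?_⟩
  obtain ⟨-, hKconv, hKdisj⟩ := hK
  obtain ⟨x, hxK, hx⟩ := exists_of_ssubset hss
  obtain ⟨z, hz, hzx⟩ := exists_inner_cubeSign_eq x
  have hgt : (d : ℝ) / 2 < inner ℝ (cubeSign z) (x - cubeCenter d) := hzx ▸ not_le.1 hx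
  -- If x violates the inequality of vertex z, a point slightly beyond z on the ray from x through z
  -- is interior to the polytope. Then z lies strictly between it and x, hence in the interior of K,
  -- though z is in S.
  have hline : Tendsto (fun ε : ℝ => z - ε • (x - z)) (nhdsWithin 0 (Ioi 0)) (nhds z) := by
    have : Continuous fun ε : ℝ => z - ε • (x - z) := by fun_prop
    simpa using (this.tendsto 0).mono_left nhdsWithin_le_nhds
  obtain ⟨ε, hε, hε0⟩ := ((hline.eventually (eventually_inner_cubeSign_eq hz)).and
    self_mem_nhdsWithin).exists
  replace hε0 : 0 < ε := hε0
  have hw : z - ε • (x - z) ∈ interior K := by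
    refine interior_mono hss.subset ?_
    rw [interior_crossPolytope hd, mem_ofPred_eq, ← hε]
    have : z - ε • (x - z) - cubeCenter d = (1 + ε) • (z - cubeCenter d) -
        ε • (x - cubeCenter d) := by module
    rw [this, inner_sub_right, inner_smul_right, inner_smul_right, inner_cubeSign_self hz]
    nlinarith
  refine hKdisj.notMem_of_mem_left (hKconv.openSegment_interior_self_subset_interior hw hxK ?_)
    (hcube hz)
  have h1 : (1 + ε) ≠ 0 := by positivity
  refine ⟨1 / (1 + ε), ε / (1 + ε), by positivity, by positivity, by field_simp, ?_⟩
  have : z = ((1 + ε)⁻¹ * (1 + ε)) • z := by rw [inv_mul_cancel₀ h1, one_smul]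
  conv_rhs => rw [this]
  module

theorem cubeCenter_mem_interior (hd : 1 ≤ d) : cubeCenter d ∈ interior (crossPolytope d) := by
  have : (1 : ℝ) ≤ d := by exact_mod_cast hd
  rw [interior_crossPolytope hd, mem_ofPred_eq]
  simp [cubeCenter]
  linarith

theorem isFullDimensional_crossPolytope (hd : 1 ≤ d) : IsFullDimensional (crossPolytope d) :=
  convex_crossPolytope.interior_nonempty_iff_affineSpan_eq_top.1 ⟨_, cubeCenter_mem_interior hd⟩

/-- The facet of the cross-polytope through the vertex `z` of the unit cube. -/
def crossFacet (z : EuclideanSpace ℝ (Fin d)) : Set (EuclideanSpace ℝ (Fin d)) :=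
  {x ∈ crossPolytope d | inner ℝ (cubeSign z) (x - cubeCenter d) = (d : ℝ) / 2}

theorem mem_crossFacet_self {z : EuclideanSpace ℝ (Fin d)} (hz : z ∈ cubeVertices d) :
    z ∈ crossFacet z :=
  ⟨((eventually_inner_cubeSign_eq hz).self_of_nhds.symm.trans (inner_cubeSign_self hz)).le,
    inner_cubeSign_self hz⟩

theorem injOn_crossFacet : InjOn crossFacet (cubeVertices d) := fun z hz y hy h => by
  by_contra hne
  exact (inner_cubeSign_lt hy hz hne).ne (h ▸ mem_crossFacet_self hz).2

theorem vectorSpan_crossFacet {z : EuclideanSpace ℝ (Fin d)} (hz : z ∈ cubeVertices d) :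
    vectorSpan ℝ (crossFacet z) = (innerSL ℝ (cubeSign z)).toLinearMap.ker := by
  apply le_antisymm
  · refine Submodule.span_le.2 ?_
    rintro _ ⟨p, hp, q, hq, rfl⟩
    have : p - q = (p - cubeCenter d) - (q - cubeCenter d) := by abel
    simp only [vsub_eq_sub, SetLike.mem_coe, LinearMap.mem_ker, ContinuousLinearMap.coe_coe,
      innerSL_apply_apply]
    rw [this, inner_sub_right, hp.2, hq.2, sub_self]
  · intro v hv
    have hv' : inner ℝ (cubeSign z) v = 0 := by simpa using hv
    have hline : Tendsto (fun ε : ℝ => z + ε • v) (nhdsWithin 0 (Ioi 0)) (nhds z) := by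
      have : Continuous fun ε : ℝ => z + ε • v := by fun_prop
      simpa using (this.tendsto 0).mono_left nhdsWithin_le_nhds
    obtain ⟨ε, hε, hε0⟩ := ((hline.eventually (eventually_inner_cubeSign_eq hz)).and
      self_mem_nhdsWithin).exists
    have hin : inner ℝ (cubeSign z) (z + ε • v - cubeCenter d) = (d : ℝ) / 2 := by
      rw [add_sub_right_comm, inner_add_right, inner_smul_right, hv', inner_cubeSign_self hz]
      simp
    have hmem : z + ε • v ∈ crossFacet z := ⟨(hε.symm.trans hin).le, hin⟩
    have h := vsub_mem_vectorSpan ℝ hmem (mem_crossFacet_self hz)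
    rw [vsub_eq_sub, add_sub_cancel_left] at h
    simpa [smul_smul, hε0.ne'] using Submodule.smul_mem _ ε⁻¹ h

theorem isFacet_crossFacet (hd : 1 ≤ d) {z : EuclideanSpace ℝ (Fin d)}
    (hz : z ∈ cubeVertices d) : IsFacet (crossPolytope d) (crossFacet z) := by
  refine ⟨fun _ => ⟨innerSL ℝ (cubeSign z), ?_⟩, ⟨z, mem_crossFacet_self hz⟩, ?_⟩
  · have hle : ∀ x ∈ crossPolytope d, inner ℝ (cubeSign z) (x - cubeCenter d) ≤ (d : ℝ) / 2 :=
      fun x hx => (inner_cubeSign_le hz x).trans hx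
    have hzz := inner_cubeSign_self hz
    ext x
    refine ⟨fun hx => ⟨hx.1, fun y hy => ?_⟩, fun hx => ⟨hx.1, (hle x hx.1).antisymm ?_⟩⟩
    · have h1 := hle y hy
      have h2 := hx.2
      rw [inner_sub_right] at h1 h2
      simp only [innerSL_apply_apply]
      linarith
    · have h1 := hx.2 z (mem_crossFacet_self hz).1
      simp only [innerSL_apply_apply] at h1
      rw [inner_sub_right] at hzz ⊢
      linarith
  · rw [vectorSpan_crossFacet hz, vectorSpan_eq_top_of_interior ⟨_, cubeCenter_mem_interior hd⟩,
      finrank_top]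
    refine Module.Dual.finrank_ker_add_one_of_ne_zero (f := (innerSL ℝ (cubeSign z)).toLinearMap)
      fun h => ?_
    have h1 := inner_cubeSign_self hz
    have h2 : inner ℝ (cubeSign z) (z - cubeCenter d) = 0 := LinearMap.congr_fun h _
    have : (1 : ℝ) ≤ d := by exact_mod_cast hd
    linarith

theorem le_of_facetBound (hd : 1 ≤ d) {S : Set (EuclideanSpace ℝ (Fin d))}
    (hS : S ⊆ integerPoints d) (hcube : cubeVertices d ⊆ S) {k : ℕ} (hk : FacetBound S k) :
    ((2 ^ d : ℕ) : ℕ∞) ≤ k := by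
  rw [← encard_cubeVertices]
  exact (encard_le_encard_of_injOn (t := {F | IsFacet (crossPolytope d) F})
    (fun z hz => isFacet_crossFacet hd hz) injOn_crossFacet).trans
    (hk _ (isMaximalSFree_crossPolytope hd hS hcube) (isFullDimensional_crossPolytope hd)).2

theorem facetComplexity_eq (hd : 1 ≤ d) {S : Set (EuclideanSpace ℝ (Fin d))}
    (hS : S ⊆ integerPoints d) (hcube : cubeVertices d ⊆ S) (hb : FacetBound S (2 ^ d)) :
    facetComplexity S = (((2 ^ d : ℕ) : ℕ∞) : WithBot ℕ∞) := by
  rw [facetComplexity, if_pos ⟨_, isMaximalSFree_crossPolytope hd hS hcube,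
    isFullDimensional_crossPolytope hd⟩]
  congr 1
  exact le_antisymm (iInf₂_le (2 ^ d) hb) (le_iInf₂ fun k hk => le_of_facetBound hd hS hcube hk)

/-! ### Punctured cubes and the lower bound for the Helly number -/

theorem isSConvex_puncturedCube {z : EuclideanSpace ℝ (Fin d)} (hz : z ∈ cubeVertices d) :
    IsSConvex (integerPoints d) (cubeVertices d \ {z}) := by
  refine ⟨{x | ∀ i, x i ∈ Icc (0 : ℝ) 1} ∩
    {x | inner ℝ (cubeSign z) (x - cubeCenter d) < (d : ℝ) / 2},
    (convex_coordBox _ _).inter (convex_inner_sub_lt _ _ _), ?_⟩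
  ext x
  constructor
  · rintro ⟨hx, hxz⟩
    refine ⟨cubeVertices_subset_integerPoints hx, fun i => ?_, inner_cubeSign_lt hz hx hxz⟩
    rcases hx i with h | h <;> rw [h] <;> simp
  · rintro ⟨hx, hx01, hlt⟩
    refine ⟨fun i => ?_, ?_⟩
    · obtain ⟨n, hn⟩ := hx i
      have h := hx01 i
      rw [hn] at h ⊢
      have h0 : 0 ≤ n := by exact_mod_cast h.1
      have h1 : n ≤ 1 := by exact_mod_cast h.2
      have : n = 0 ∨ n = 1 := by omega
      rcases this with rfl | rfl <;> simp
    · rintro rfl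
      exact hlt.ne (inner_cubeSign_self hz)

theorem injOn_puncturedCube :
    InjOn (fun z => cubeVertices d \ {z}) (cubeVertices d) := fun z hz y _ h => by
  by_contra hne
  have : z ∈ cubeVertices d \ {z} := by
    rw [show cubeVertices d \ {z} = cubeVertices d \ {y} from h]
    exact ⟨hz, hne⟩
  exact this.2 rfl

theorem encard_puncturedCubes : (puncturedCubes d).encard = ((2 ^ d : ℕ) : ℕ∞) := by
  rw [puncturedCubes, injOn_puncturedCube.encard_image, encard_cubeVertices]

theorem sInter_puncturedCubes : ⋂₀ puncturedCubes d = ∅ := by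
  refine eq_empty_of_forall_notMem fun x hx => ?_
  obtain ⟨z, hz⟩ := cubeVertices_nonempty (d := d)
  have hxc : x ∈ cubeVertices d := (hx _ (mem_image_of_mem _ hz)).1
  exact (hx _ (mem_image_of_mem _ hxc)).2 rfl

theorem sInter_nonempty_of_ssubset_puncturedCubes
    {𝓖 : Set (Set (EuclideanSpace ℝ (Fin d)))} (h : 𝓖 ⊂ puncturedCubes d) : (⋂₀ 𝓖).Nonempty := by
  obtain ⟨A, ⟨z, hz, rfl⟩, hA⟩ := exists_of_ssubset h
  refine ⟨z, fun B hB => ?_⟩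
  obtain ⟨y, -, rfl⟩ := h.subset hB
  refine ⟨hz, ?_⟩
  rintro rfl
  exact hA hB

theorem le_of_hellyCondition {k : ℕ}
    (hk : HellyCondition {A | IsSConvex (integerPoints d) A} k) : 2 ^ d ≤ k := by
  let e : Fin (2 ^ d) ≃ (Fin d → Bool) := (Fintype.equivFinOfCardEq (by simp)).symm
  have hcube : ∀ b : Fin d → Bool, cubeVertex b ∈ cubeVertices d := fun b =>
    range_cubeVertex ▸ mem_range_self b
  obtain ⟨f, hf⟩ := hk (2 ^ d) Nat.one_le_two_pow
    (fun j => cubeVertices d \ {cubeVertex (e j)}) (fun j => isSConvex_puncturedCube (hcube _)) (by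
      refine eq_empty_of_forall_notMem fun x hx => ?_
      rw [mem_iInter] at hx
      obtain ⟨b, rfl⟩ : x ∈ range cubeVertex :=
        range_cubeVertex ▸ (hx ⟨0, Nat.two_pow_pos d⟩).1
      exact (hx (e.symm b)).2 (by simp))
  -- If the tuple omits index j, the vertex removed only in the j-th set lies in all the chosen
  -- sets.
  have hsurj : Function.Surjective f := fun j => by
    by_contra! hcon
    refine (hf ▸ mem_iInter.2 fun i => ⟨hcube (e j), fun h => hcon i ?_⟩ :
      cubeVertex (e j) ∈ (∅ : Set _))
    exact (e.injective (cubeVertex_injective h)).symm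
  simpa using Fintype.card_le_of_surjective f hsurj

theorem sHellyNumber_integerPoints : sHellyNumber (integerPoints d) = ((2 ^ d : ℕ) : ℕ∞) := by
  have hne : {A | IsSConvex (integerPoints d) A} ≠ {∅} := fun h => by
    have hmem : integerPoints d ∈ {A | IsSConvex (integerPoints d) A} :=
      ⟨univ, convex_univ, (inter_univ _).symm⟩
    rw [h, mem_singleton_iff] at hmem
    obtain ⟨z, hz⟩ := cubeVertices_nonempty (d := d)
    exact (hmem ▸ cubeVertices_subset_integerPoints hz : z ∈ (∅ : Set _))
  rw [sHellyNumber, hellyNumber, if_neg hne]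
  refine le_antisymm (iInf₂_le (2 ^ d) ⟨Nat.one_le_two_pow, hellyCondition_integerPoints d⟩)
    (le_iInf₂ fun k hk => ?_)
  exact_mod_cast le_of_hellyCondition hk.2

end Cube

/-! ### Exact values and the main theorem -/

theorem facetComplexity_integerPoints {d : ℕ} (hd : 1 ≤ d) :
    facetComplexity (integerPoints d) = (((2 ^ d : ℕ) : ℕ∞) : WithBot ℕ∞) :=
  facetComplexity_eq hd subset_rfl cubeVertices_subset_integerPoints (facetBound_integerPoints d)

theorem facetComplexity_integerBox {d t : ℕ} (hd : 1 ≤ d) (ht : 1 ≤ t) :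
    facetComplexity (integerBox d t) = (((2 ^ d : ℕ) : ℕ∞) : WithBot ℕ∞) :=
  facetComplexity_eq hd inter_subset_left (cubeVertices_subset_integerBox ht)
    (facetBound_integerBox d t)

theorem mainTheorem6 (d : ℕ) (hd : 1 ≤ d) :
    -- the two functionals agree on `ℤ^d`, and their common value is `2^d`
    ((sHellyNumber (integerPoints d) : ℕ∞) : WithBot ℕ∞) = facetComplexity (integerPoints d) ∧
    sHellyNumber (integerPoints d) = ((2 ^ d : ℕ) : ℕ∞) ∧
    facetComplexity (integerPoints d) = (((2 ^ d : ℕ) : ℕ∞) : WithBot ℕ∞) ∧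
    -- the family of the sets `{0, 1}^d \ {z}`
    ((∀ A ∈ puncturedCubes d, IsSConvex (integerPoints d) A) ∧
      (puncturedCubes d).encard = ((2 ^ d : ℕ) : ℕ∞) ∧
      ⋂₀ puncturedCubes d = ∅ ∧
      ∀ 𝓖 : Set (Set (EuclideanSpace ℝ (Fin d))), 𝓖 ⊂ puncturedCubes d → (⋂₀ 𝓖).Nonempty) ∧
    -- the bounded pieces `ℤ^d ∩ [-t, t]^d`
    (facetComplexity (integerPoints d) ≤
        liminf (fun t : ℕ => facetComplexity (integerBox d t)) atTop ∧
      ∀ t : ℕ, 1 ≤ t →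
        facetComplexity (integerBox d t) ≤ (((2 ^ d : ℕ) : ℕ∞) : WithBot ℕ∞)) := by
  have hf := facetComplexity_integerPoints hd
  have hh := sHellyNumber_integerPoints (d := d)
  refine ⟨by rw [hf, hh], hh, hf, ⟨?_, encard_puncturedCubes, sInter_puncturedCubes,
    fun 𝓖 h𝓖 => sInter_nonempty_of_ssubset_puncturedCubes h𝓖⟩, ?_,
    fun t ht => (facetComplexity_integerBox hd ht).le⟩
  · rintro _ ⟨z, hz, rfl⟩
    exact isSConvex_puncturedCube hz
  · have hev : ∀ᶠ t : ℕ in atTop, facetComplexity (integerBox d t) =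
        (((2 ^ d : ℕ) : ℕ∞) : WithBot ℕ∞) :=
      (eventually_ge_atTop 1).mono fun t ht => facetComplexity_integerBox hd ht
    rw [hf, liminf_congr hev, liminf_const]
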